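/- Let $G=(V,E)$ be a finite simple connected graph. A block of $G$ is a cut edge (with its two endpoints) or a maximal $2$-connected subgraph of $G$ ($2$-connected: connected, at least three vertices, no cut vertex). The block-cut tree $T_G$ has as nodes the blocks and the cut vertices of $G$, a block $B$ being adjacent to a cut vertex $z$ exactly when $z\in V(B)$. For $S\subseteq V$ let $$I(S)=S\cup\{v\in V : v \text{ lies on a path of } G \text{ with both endpoints in } S\}$$ be the interval of $S$ in the all-path convexity. For a subtree $T$ of $T_G$ put $U(T)=\bigcup_{B_j\in V(T)}V(B_j)$, the union being over the blocks that are nodes of $T$. Call $T$ admissible for $S$ if every leaf of $T$ is a block containing a vertex of $S$ that is not a cut vertex of the induced subgraph $G[U(T)]$, and $U(T)$ contains at least two vertices of $S$. (The node of a one-node tree counts as a leaf; the last condition only excludes one-node trees whose block contains a single vertex of $S$.) Theorem. Let $S\subseteq V$ with $|S|\ge 2$. Then among the subtrees of $T_G$ that are admissible for $S$ there is a largest one, $T_S$ (it contains every other one), and $$I(S)=\bigcup_{B_j\in V(T_S)}V(B_j).$$ -/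

import Mathlib

universe u

/-- The interval function of the all-path convexity: `S` together with all vertices lying on a
path of `G` with endpoints in `S`. -/
def allPathInterval {V : Type u} (G : SimpleGraph V) (S : Set V) : Set V :=
  S ∪ {v | ∃ s ∈ S, ∃ t ∈ S, ∃ p : G.Walk s t, p.IsPath ∧ v ∈ p.support}

/-- `z` is a cut vertex of `H`: deleting `z` separates two vertices that are connected in `H`. -/
def IsCutVertex {W : Type u} (H : SimpleGraph W) (z : W) : Prop :=
  ∃ a b : ({z}ᶜ : Set W), H.Reachable a.1 b.1 ∧ ¬ (H.induce ({z}ᶜ : Set W)).Reachable a b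

/-- A (finite) graph is 2-connected if it has at least three vertices, is connected, and has no
cut vertex. -/
def IsTwoConnected {W : Type u} (H : SimpleGraph W) : Prop :=
  3 ≤ Nat.card W ∧ H.Connected ∧ ∀ z, ¬ IsCutVertex H z

/-- A block of `G` is a cut edge or a maximal 2-connected subgraph of `G`. -/
def IsBlock {V : Type u} (G : SimpleGraph V) (B : G.Subgraph) : Prop :=
  (∃ (a b : V) (h : G.Adj a b), G.IsBridge s(a, b) ∧ B = G.subgraphOfAdj h) ∨
    Maximal (fun H : G.Subgraph => IsTwoConnected H.coe) B

/-- The vertices of the block-cut tree: the blocks and the cut vertices of `G`. -/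
abbrev BlockCutVertex {V : Type u} (G : SimpleGraph V) : Type u :=
  {B : G.Subgraph // IsBlock G B} ⊕ {z : V // IsCutVertex G z}

/-- The block-cut tree of `G`: a block is joined to the cut vertices of `G` that it contains. -/
def blockCutTree {V : Type u} (G : SimpleGraph V) : SimpleGraph (BlockCutVertex G) where
  Adj
    | .inl B, .inr z => z.1 ∈ B.1.verts
    | .inr z, .inl B => z.1 ∈ B.1.verts
    | .inl _, .inl _ => False
    | .inr _, .inr _ => False
  symm := ⟨by rintro (B | z) (B' | z') h <;> exact h⟩
  loopless := ⟨by rintro (B | z) h <;> exact h⟩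

/-- The union of the vertex sets of the blocks that are nodes of `T`. -/
def blockUnion {V : Type u} {G : SimpleGraph V} (T : (blockCutTree G).Subgraph) : Set V :=
  ⋃ B ∈ {B : {B : G.Subgraph // IsBlock G B} | Sum.inl B ∈ T.verts}, B.1.verts

/-- `T` is a subtree of the block-cut tree of `G` each of whose leaves is a block containing a
vertex of `S` that is not a cut vertex of the subgraph of `G` induced by the union of the blocks
of `T`.  The node of a one-node tree counts as a leaf. The condition `nontrivial` only excludes
trees that consist of one block with a single vertex of `S`: two distinct leaves of a tree `T`
satisfying `leaf` always provide two distinct vertices of `S`. -/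
structure IsLeafAdmissible {V : Type u} (G : SimpleGraph V) (S : Set V)
    (T : (blockCutTree G).Subgraph) : Prop where
  isTree : T.coe.IsTree
  leaf : ∀ x ∈ T.verts, (T.neighborSet x).Subsingleton →
    ∃ B : {B : G.Subgraph // IsBlock G B}, x = Sum.inl B ∧
      ∃ s : blockUnion T, s.1 ∈ S ∧ s.1 ∈ B.1.verts ∧
        ¬ IsCutVertex (G.induce (blockUnion T)) s
  nontrivial : (S ∩ blockUnion T).Nontrivial

/-- `T` is the subtree `T_S`: the largest subtree of the block-cut tree satisfying the leaf
condition. -/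
def IsMaximalSubtree {V : Type u} (G : SimpleGraph V) (S : Set V)
    (T : (blockCutTree G).Subgraph) : Prop :=
  IsGreatest {T' | IsLeafAdmissible G S T'} T

namespace SimpleGraph

/-! The vertex sets of blocks are the maximal sets with at least two elements that stay connected
after deleting at most one vertex (`isBlock_iff`); two of them share at most one vertex. Call a
block unseparated if, for each of its vertices `z`, some vertex of `S` can be reached in `G - z`
from the rest of the block. Both sides of the theorem are governed by these blocks.

They cover exactly `I(S)`. An edge of a path between vertices of `S` lies in a block, and the two
ends of the path witness that this block is unseparated. Conversely, given an unseparated block and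
`s ∈ S`, let `g` be its gate towards `s`, and let `t ∈ S` be reachable from the rest of the block
without `g`. Every `s`-`t` path then runs through `g` and on to another vertex of the block, and can
be rerouted inside the block through any prescribed vertex (`Solid.exists_isPath_mem`).

Together with the cut vertices they share, they form the largest admissible subtree. It is
connected, since a path from an unseparated block to a vertex of `S` passes only through unseparated
blocks (`Unseparated.of_adj`). At a leaf, the witness in `S` for the attaching vertex must lie in
the leaf itself. Every block of an admissible tree is unseparated: moving through the tree away from
`z` ends at a leaf, which supplies a vertex of `S` (`IsLeafAdmissible.unseparated`). -/

variable {V : Type u} {G : SimpleGraph V} {S U X Y Z : Set V} {a b c s t u v w x y z : V}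

/-! ### Walks inside a vertex set -/

/-- `a` and `b` are joined by a walk of `G` all of whose vertices lie in `Z`. -/
def LinkedIn (G : SimpleGraph V) (Z : Set V) (a b : V) : Prop :=
  ∃ p : G.Walk a b, ∀ x ∈ p.support, x ∈ Z

namespace LinkedIn

theorem refl (h : a ∈ Z) : G.LinkedIn Z a a := ⟨.nil, by simpa⟩

theorem symm (h : G.LinkedIn Z a b) : G.LinkedIn Z b a := by
  obtain ⟨p, hp⟩ := h
  exact ⟨p.reverse, by simpa using hp⟩

theorem trans (h : G.LinkedIn Z a b) (h' : G.LinkedIn Z b c) : G.LinkedIn Z a c := by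
  obtain ⟨p, hp⟩ := h
  obtain ⟨q, hq⟩ := h'
  refine ⟨p.append q, fun x hx => ?_⟩
  rw [Walk.mem_support_append_iff] at hx
  exact hx.elim (hp x) (hq x)

theorem mono (h : G.LinkedIn Y a b) (hYZ : Y ⊆ Z) : G.LinkedIn Z a b := by
  obtain ⟨p, hp⟩ := h
  exact ⟨p, fun x hx => hYZ (hp x hx)⟩

theorem left_mem (h : G.LinkedIn Z a b) : a ∈ Z := by
  obtain ⟨p, hp⟩ := h
  exact hp _ p.start_mem_support

theorem right_mem (h : G.LinkedIn Z a b) : b ∈ Z := h.symm.left_mem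

theorem exists_isPath (h : G.LinkedIn Z a b) :
    ∃ p : G.Walk a b, p.IsPath ∧ ∀ x ∈ p.support, x ∈ Z := by
  classical
  obtain ⟨p, hp⟩ := h
  exact ⟨p.bypass, p.bypass_isPath, fun x hx => hp x (p.support_bypass_subset_support hx)⟩

end LinkedIn

theorem Adj.linkedIn (h : G.Adj a b) (ha : a ∈ Z) (hb : b ∈ Z) : G.LinkedIn Z a b :=
  ⟨.cons h .nil, by simp [ha, hb]⟩

theorem Walk.mem_support_map_iff {W : Type*} {H : SimpleGraph W} {f : H →g G} {u v : W}
    {p : H.Walk u v} : x ∈ (p.map f).support ↔ ∃ y ∈ p.support, f y = x := by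
  rw [Walk.support_map, List.mem_map]

theorem linkedIn_iff_reachable_induce (ha : a ∈ Z) (hb : b ∈ Z) :
    G.LinkedIn Z a b ↔ (G.induce Z).Reachable ⟨a, ha⟩ ⟨b, hb⟩ := by
  constructor
  · rintro ⟨p, hp⟩
    exact ⟨p.induce Z hp⟩
  · rintro ⟨p⟩
    refine ⟨p.map (Embedding.induce Z).toHom, fun x hx => ?_⟩
    obtain ⟨y, -, rfl⟩ := Walk.mem_support_map_iff.1 hx
    exact y.2

theorem isCutVertex_iff_linkedIn :
    IsCutVertex G z ↔ ∃ a b, a ≠ z ∧ b ≠ z ∧ G.Reachable a b ∧ ¬ G.LinkedIn {z}ᶜ a b := by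
  constructor
  · rintro ⟨a, b, h, h'⟩
    exact ⟨a, b, a.2, b.2, h, fun h'' => h' ((linkedIn_iff_reachable_induce a.2 b.2).1 h'')⟩
  · rintro ⟨a, b, ha, hb, h, h'⟩
    exact ⟨⟨a, ha⟩, ⟨b, hb⟩, h, fun h'' => h' ((linkedIn_iff_reachable_induce _ _).2 h'')⟩

theorem linkedIn_induce_iff {a b : X} {Z : Set X} :
    (G.induce X).LinkedIn Z a b ↔ G.LinkedIn (Subtype.val '' Z) a b := by
  constructor
  · rintro ⟨p, hp⟩
    refine ⟨p.map (Embedding.induce X).toHom, fun x hx => ?_⟩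
    obtain ⟨y, hy, rfl⟩ := Walk.mem_support_map_iff.1 hx
    exact ⟨y, hp y hy, rfl⟩
  · rintro ⟨p, hp⟩
    have hX : ∀ x ∈ p.support, x ∈ X := fun x hx => by
      obtain ⟨y, -, rfl⟩ := hp x hx
      exact y.2
    refine ⟨p.induce X hX, fun x hx => ?_⟩
    have hx' : x.1 ∈ p.support := by simpa using hx
    obtain ⟨y, hy, hyx⟩ := hp _ hx'
    rwa [← Subtype.ext hyx]

theorem isCutVertex_induce_iff {z : X} :
    IsCutVertex (G.induce X) z ↔
      ∃ a ∈ X \ {z.1}, ∃ b ∈ X \ {z.1}, G.LinkedIn X a b ∧ ¬ G.LinkedIn (X \ {z.1}) a b := by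
  have him : (Subtype.val '' ({z}ᶜ : Set X)) = X \ {z.1} := by
    ext x
    simp
  rw [isCutVertex_iff_linkedIn]
  constructor
  · rintro ⟨a, b, ha, hb, h, h'⟩
    refine ⟨a, ⟨a.2, fun h => ha (Subtype.ext h)⟩, b, ⟨b.2, fun h => hb (Subtype.ext h)⟩,
      (linkedIn_iff_reachable_induce a.2 b.2).2 h, ?_⟩
    rwa [linkedIn_induce_iff, him] at h'
  · rintro ⟨a, ha, b, hb, h, h'⟩
    refine ⟨⟨a, ha.1⟩, ⟨b, hb.1⟩, fun h => ha.2 (congrArg Subtype.val h),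
      fun h => hb.2 (congrArg Subtype.val h), (linkedIn_iff_reachable_induce _ _).1 h, ?_⟩
    rwa [linkedIn_induce_iff, him]

/-- A path visits each vertex at most once: it avoids `y` either before or after `x`. -/
theorem Walk.IsPath.linkedIn_or_linkedIn {p : G.Walk a b} (hp : p.IsPath) (hx : x ∈ p.support)
    (hxy : x ≠ y) :
    G.LinkedIn {v | v ∈ p.support ∧ v ≠ y} a x ∨ G.LinkedIn {v | v ∈ p.support ∧ v ≠ y} x b := by
  classical
  by_cases hy : y ∈ (p.takeUntil x hx).support
  · right
    refine ⟨p.dropUntil x hx, fun v hv => ⟨p.support_dropUntil_subset_support hx hv, ?_⟩⟩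
    rintro rfl
    have hq : ((p.takeUntil x hx).append (p.dropUntil x hx)).IsPath := by rwa [p.take_spec hx]
    have := hq.support_nodup
    rw [Walk.support_append] at this
    have hd := List.disjoint_of_nodup_append this
    rw [← Walk.cons_tail_support] at hv
    rcases List.mem_cons.1 hv with h | h
    · exact hxy h.symm
    · exact hd hy h
  · left
    refine ⟨p.takeUntil x hx, fun v hv => ⟨p.support_takeUntil_subset_support hx hv, ?_⟩⟩
    rintro rfl
    exact hy hv

theorem Walk.IsPath.append {p : G.Walk a b} {q : G.Walk b c} (hp : p.IsPath) (hq : q.IsPath)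
    (h : ∀ x ∈ p.support, x ∈ q.support → x = b) : (p.append q).IsPath := by
  rw [Walk.isPath_def, Walk.support_append]
  have hq' := hq.support_nodup
  rw [← Walk.cons_tail_support, List.nodup_cons] at hq'
  refine List.Nodup.append hp.support_nodup hq'.2 fun x hx hx' => ?_
  obtain rfl := h x hx (List.mem_of_mem_tail hx')
  exact hq'.1 hx'

/-! ### Solid sets -/

/-- A vertex set inducing a connected subgraph that stays connected when a vertex is deleted. -/
def Solid (G : SimpleGraph V) (X : Set V) : Prop :=
  ∀ Y : Set V, Y.Subsingleton → ∀ a ∈ X \ Y, ∀ b ∈ X \ Y, G.LinkedIn (X \ Y) a b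

theorem Solid.linkedIn (hX : G.Solid X) (ha : a ∈ X) (hb : b ∈ X) : G.LinkedIn X a b := by
  simpa using hX ∅ Set.subsingleton_empty a (by simpa) b (by simpa)

theorem Solid.linkedIn_diff (hX : G.Solid X) (ha : a ∈ X) (hb : b ∈ X) (hay : a ≠ y)
    (hby : b ≠ y) : G.LinkedIn (X \ {y}) a b :=
  hX {y} Set.subsingleton_singleton a ⟨ha, hay⟩ b ⟨hb, hby⟩

theorem Solid.linkedIn_compl (hX : G.Solid X) (ha : a ∈ X) (hb : b ∈ X) (hay : a ≠ y)
    (hby : b ≠ y) : G.LinkedIn {y}ᶜ a b :=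
  (hX.linkedIn_diff ha hb hay hby).mono fun _ h => h.2

theorem solid_iff : G.Solid X ↔ (∀ a ∈ X, ∀ b ∈ X, G.LinkedIn X a b) ∧
    ∀ y, ∀ a ∈ X \ {y}, ∀ b ∈ X \ {y}, G.LinkedIn (X \ {y}) a b := by
  refine ⟨fun h => ⟨fun a ha b hb => h.linkedIn ha hb,
    fun y => h {y} Set.subsingleton_singleton⟩, fun ⟨h, h'⟩ Y hY => ?_⟩
  rcases hY.eq_empty_or_singleton with rfl | ⟨y, rfl⟩
  · simpa using h
  · exact h' y

/-- Of two common vertices at least one survives the deletion, and everything left is joined to it.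
-/
theorem Solid.union (hX : G.Solid X) (hY : G.Solid Y) (h : (X ∩ Y).Nontrivial) :
    G.Solid (X ∪ Y) := by
  intro W hW
  obtain ⟨c, hc, hcW⟩ : ∃ c ∈ X ∩ Y, c ∉ W := by
    by_contra! hcon
    exact (Set.not_subsingleton_iff.2 h) (hW.anti hcon)
  have key : ∀ a ∈ (X ∪ Y) \ W, G.LinkedIn ((X ∪ Y) \ W) a c := by
    rintro a ⟨ha | ha, haW⟩
    · exact (hX W hW a ⟨ha, haW⟩ c ⟨hc.1, hcW⟩).mono
        (Set.sdiff_subset_sdiff_left Set.subset_union_left)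
    · exact (hY W hW a ⟨ha, haW⟩ c ⟨hc.2, hcW⟩).mono
        (Set.sdiff_subset_sdiff_left Set.subset_union_right)
  exact fun a ha b hb => (key a ha).trans (key b hb).symm

theorem Adj.solid (h : G.Adj a b) : G.Solid {a, b} := by
  rintro W - c ⟨hc, hcy⟩ d ⟨hd, hdy⟩
  rcases hc with rfl | rfl <;> rcases hd with rfl | rfl
  · exact .refl ⟨by simp, hcy⟩
  · exact h.linkedIn ⟨by simp, hcy⟩ ⟨by simp, hdy⟩
  · exact h.symm.linkedIn ⟨by simp, hcy⟩ ⟨by simp, hdy⟩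
  · exact .refl ⟨by simp, hcy⟩

/-- The vertex set of a cycle is solid. -/
theorem Walk.IsPath.solid_insert {p : G.Walk a b} (hp : p.IsPath) (hz : z ∉ p.support)
    (ha : G.Adj z a) (hb : G.Adj z b) : G.Solid (insert z {x | x ∈ p.support}) := by
  classical
  set X := insert z {x | x ∈ p.support}
  have hp' : ∀ c ∈ p.support, G.LinkedIn (X \ {z}) a c := fun c hc =>
    ⟨p.takeUntil c hc, fun x hx => ⟨.inr (p.support_takeUntil_subset_support hc hx), fun h =>
      hz (h ▸ p.support_takeUntil_subset_support hc hx)⟩⟩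
  rw [solid_iff]
  constructor
  · have key : ∀ c ∈ X, G.LinkedIn X z c := by
      rintro c (rfl | hc)
      · exact .refl (.inl rfl)
      · exact (ha.linkedIn (.inl rfl) (.inr p.start_mem_support)).trans
          ((hp' c hc).mono Set.sdiff_subset)
    exact fun c hc d hd => (key c hc).symm.trans (key d hd)
  · intro y
    by_cases hyz : y = z
    · subst hyz
      have key : ∀ c ∈ X \ {y}, G.LinkedIn (X \ {y}) a c := by
        rintro c ⟨hc | hc, hcy⟩
        · exact (hcy hc).elim
        · exact hp' c hc
      exact fun c hc d hd => (key c hc).symm.trans (key d hd)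
    · have hmono : {v | v ∈ p.support ∧ v ≠ y} ⊆ X \ {y} := fun v hv => ⟨.inr hv.1, hv.2⟩
      have hzy : z ∈ X \ {y} := ⟨.inl rfl, fun h => hyz h.symm⟩
      have key : ∀ c ∈ X \ {y}, G.LinkedIn (X \ {y}) z c := by
        rintro c ⟨rfl | hc, hcy⟩
        · exact .refl hzy
        -- The path avoids `y` on one side of `c`, and that side leads to `z` through `a` or through
        -- `b`.
        · rcases hp.linkedIn_or_linkedIn hc hcy with h | h
          · have h' := h.mono hmono
            exact (ha.linkedIn hzy h'.left_mem).trans h'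
          · have h' := (h.mono hmono).symm
            exact (hb.linkedIn hzy h'.left_mem).trans h'
      exact fun c hc d hd => (key c hc).symm.trans (key d hd)

theorem Solid.exists_adj (hX : G.Solid X) (hn : X.Nontrivial) (hz : z ∈ X) :
    ∃ a ∈ X, G.Adj z a := by
  obtain ⟨b, hb, hbz⟩ := hn.exists_ne z
  obtain ⟨p, hp⟩ := hX.linkedIn hz hb
  cases p with
  | nil => exact (hbz rfl).elim
  | cons h q => exact ⟨_, hp _ (by simp), h⟩

/-! ### Maximal solid sets -/

/-- A vertex set that is maximal among the solid sets with at least two elements. -/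
def MaxSolid (G : SimpleGraph V) (X : Set V) : Prop :=
  Maximal (fun X => X.Nontrivial ∧ G.Solid X) X

theorem MaxSolid.nontrivial (h : G.MaxSolid X) : X.Nontrivial := h.1.1

theorem MaxSolid.solid (h : G.MaxSolid X) : G.Solid X := h.1.2

theorem MaxSolid.subset_of_solid (hX : G.MaxSolid X) (hY : G.Solid Y)
    (h : (X ∩ Y).Nontrivial) : Y ⊆ X :=
  Set.subset_union_right.trans (hX.2 ⟨hX.nontrivial.mono Set.subset_union_left,
    hX.solid.union hY h⟩ Set.subset_union_left)

theorem MaxSolid.eq_of_nontrivial (hX : G.MaxSolid X) (hY : G.MaxSolid Y)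
    (h : (X ∩ Y).Nontrivial) : X = Y :=
  (hY.subset_of_solid hX.solid (by rwa [Set.inter_comm])).antisymm
    (hX.subset_of_solid hY.solid h)

theorem MaxSolid.eq_of_mem (hX : G.MaxSolid X) (hY : G.MaxSolid Y) (hab : a ≠ b)
    (ha : a ∈ X) (hb : b ∈ X) (ha' : a ∈ Y) (hb' : b ∈ Y) : X = Y :=
  hX.eq_of_nontrivial hY ⟨a, ⟨ha, ha'⟩, b, ⟨hb, hb'⟩, hab⟩

/-- Two blocks with a common vertex `z` coincide if they are joined in `G - z`. -/
theorem MaxSolid.eq_of_linkedIn (hX : G.MaxSolid X) (hY : G.MaxSolid Y) (hzX : z ∈ X)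
    (hzY : z ∈ Y) (ha : a ∈ X) (haz : a ≠ z) (hb : b ∈ Y) (hbz : b ≠ z)
    (h : G.LinkedIn {z}ᶜ a b) : X = Y := by
  obtain ⟨a', ha', haz'⟩ := hX.solid.exists_adj hX.nontrivial hzX
  obtain ⟨b', hb', hbz'⟩ := hY.solid.exists_adj hY.nontrivial hzY
  have h' : G.LinkedIn {z}ᶜ a' b' :=
    ((hX.solid.linkedIn_compl ha' ha haz'.ne' haz).trans h).trans
      (hY.solid.linkedIn_compl hb hb' hbz hbz'.ne')
  -- Closing this path at `z` gives a solid set that shares `z` and `a'` with `X`, so `X` absorbs it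
  -- and contains `b'` as well.
  obtain ⟨p, hp, hpz⟩ := h'.exists_isPath
  have hs := hp.solid_insert (fun h => hpz z h rfl) haz' hbz'
  have hsX := hX.subset_of_solid hs
    ⟨z, ⟨hzX, .inl rfl⟩, a', ⟨ha', .inr p.start_mem_support⟩, haz'.ne⟩
  exact hX.eq_of_mem hY hbz'.ne hzX (hsX (.inr p.end_mem_support)) hzY hb'

theorem Solid.exists_maxSolid [Finite V] (hX : G.Solid X) (hn : X.Nontrivial) :
    ∃ Y, X ⊆ Y ∧ G.MaxSolid Y :=
  (Set.toFinite {Y : Set V | Y.Nontrivial ∧ G.Solid Y}).exists_le_maximal ⟨hn, hX⟩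

theorem Adj.exists_maxSolid [Finite V] (h : G.Adj a b) : ∃ X, a ∈ X ∧ b ∈ X ∧ G.MaxSolid X := by
  obtain ⟨Y, hY, hY'⟩ := h.solid.exists_maxSolid (Set.nontrivial_pair h.ne)
  exact ⟨Y, hY (by simp), hY (by simp), hY'⟩

theorem MaxSolid.mem_of_linkedIn [Finite V] (hX : G.MaxSolid X) (hz : z ∈ X) (ha : a ∈ X)
    (haz : a ≠ z) (hb : G.Adj z b) (h : G.LinkedIn {z}ᶜ a b) : b ∈ X := by
  obtain ⟨Y, hzY, hbY, hY⟩ := hb.exists_maxSolid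
  rwa [hX.eq_of_linkedIn hY hz hzY ha haz hbY hb.ne' h]

/-! ### Blocks as maximal solid sets -/

theorem solid_of_isTwoConnected {B : G.Subgraph} (hB : IsTwoConnected B.coe) :
    G.Solid B.verts := by
  obtain ⟨-, hc, hcut⟩ := hB
  have hlink : ∀ a ∈ B.verts, ∀ b ∈ B.verts, G.LinkedIn B.verts a b := by
    intro a ha b hb
    obtain ⟨p⟩ := hc.preconnected ⟨a, ha⟩ ⟨b, hb⟩
    refine ⟨p.map B.hom, fun x hx => ?_⟩
    obtain ⟨y, -, rfl⟩ := Walk.mem_support_map_iff.1 hx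
    exact y.2
  refine solid_iff.2 ⟨hlink, ?_⟩
  rintro y a ⟨ha, hay⟩ b ⟨hb, hby⟩
  by_cases hy : y ∈ B.verts
  · have h := hcut ⟨y, hy⟩
    rw [isCutVertex_iff_linkedIn] at h
    push Not at h
    obtain ⟨p, hp⟩ := h ⟨a, ha⟩ ⟨b, hb⟩ (fun h => hay (congrArg Subtype.val h))
      (fun h => hby (congrArg Subtype.val h)) (hc.preconnected _ _)
    refine ⟨p.map B.hom, fun x hx => ?_⟩
    obtain ⟨w, hw, rfl⟩ := Walk.mem_support_map_iff.1 hx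
    exact ⟨w.2, fun h => hp w hw (Subtype.ext h)⟩
  · rw [Set.sdiff_singleton_eq_self hy]
    exact hlink a ha b hb

theorem isTwoConnected_induce_of_solid [Finite V] (hX : G.Solid X) (h3 : 3 ≤ X.ncard) :
    IsTwoConnected ((⊤ : G.Subgraph).induce X).coe := by
  have hc : IsTwoConnected (G.induce X) := by
    refine ⟨by rwa [Nat.card_coe_set_eq], ?_, fun z hz => ?_⟩
    · have hne : X.Nonempty := Set.nonempty_of_ncard_ne_zero (by lia)
      have := hne.to_subtype
      exact ⟨fun a b => (linkedIn_iff_reachable_induce a.2 b.2).1 (hX.linkedIn a.2 b.2)⟩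
    · rw [isCutVertex_induce_iff] at hz
      obtain ⟨a, ha, b, hb, -, h⟩ := hz
      exact h (hX.linkedIn_diff ha.1 hb.1 ha.2 hb.2)
  rw [induce_eq_coe_induce_top] at hc
  exact hc

/-- A third vertex `c` of a larger solid set could be reached from `a` without `b` and from `b`
without `a`; the combined walk would bypass the edge. -/
theorem isBridge_maxSolid (h : G.Adj a b) (hb : G.IsBridge s(a, b)) : G.MaxSolid {a, b} := by
  refine ⟨⟨Set.nontrivial_pair h.ne, h.solid⟩, ?_⟩
  rintro Y ⟨-, hY⟩ hsub c hc
  by_contra hcon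
  have hca : c ≠ a := fun h => hcon (.inl h)
  have hcb : c ≠ b := fun h => hcon (.inr h)
  have ha : a ∈ Y := hsub (by simp)
  have hb' : b ∈ Y := hsub (by simp)
  obtain ⟨p, hp⟩ := hY.linkedIn_diff ha hc h.ne hcb
  obtain ⟨q, hq⟩ := hY.linkedIn_diff hc hb' hca h.ne'
  have := isBridge_iff_forall_walk_mem_edges.1 hb (p.append q)
  rw [Walk.edges_append, List.mem_append] at this
  rcases this with h | h
  · exact (hp b (p.snd_mem_support_of_mem_edges h)).2 rfl
  · exact (hq a (q.fst_mem_support_of_mem_edges h)).2 rfl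

/-- An edge that is not a bridge lies on a cycle, a solid set with a third vertex, contradicting
maximality. -/
theorem MaxSolid.isBridge (hX : G.MaxSolid {a, b}) (h : G.Adj a b) : G.IsBridge s(a, b) := by
  classical
  by_contra hcon
  rw [isBridge_iff_forall_walk_mem_edges] at hcon
  push Not at hcon
  obtain ⟨p, hp⟩ := hcon
  have hq : s(a, b) ∉ p.bypass.edges := fun h => hp (p.edges_bypass_subset_edges h)
  have hpath := p.bypass_isPath
  revert hq hpath
  generalize p.bypass = q
  intro hq hpath
  cases q with
  | nil => exact h.ne rfl
  | @cons _ c _ hac q =>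
    rw [Walk.cons_isPath_iff] at hpath
    have hs := hX.subset_of_solid (hpath.1.solid_insert hpath.2 hac h)
      ⟨a, ⟨by simp, .inl rfl⟩, b, ⟨by simp, .inr q.end_mem_support⟩, h.ne⟩
    rcases hs (.inr q.start_mem_support) with hc | hc
    · exact hac.ne hc.symm
    · obtain rfl : c = b := hc
      exact hq (by simp)

/-- The blocks are the subgraphs induced by the maximal solid sets. -/
theorem isBlock_iff [Finite V] {B : G.Subgraph} :
    IsBlock G B ↔ G.MaxSolid B.verts ∧ B = (⊤ : G.Subgraph).induce B.verts := by
  constructor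
  · rintro (⟨a, b, h, hb, rfl⟩ | hB)
    · exact ⟨isBridge_maxSolid h hb, Subgraph.subgraphOfAdj_eq_induce h⟩
    · have h3 : 3 ≤ B.verts.ncard := by
        rw [← Nat.card_coe_set_eq]
        exact hB.1.1
      have hle : B ≤ (⊤ : G.Subgraph).induce B.verts := Subgraph.le_induce_top_verts
      have hmax : ∀ Y, G.Solid Y → B.verts ⊆ Y → (⊤ : G.Subgraph).induce Y ≤ B := fun Y hY hBY =>
        hB.2 (isTwoConnected_induce_of_solid hY (h3.trans (Set.ncard_le_ncard hBY)))
          (hle.trans (Subgraph.induce_mono_right hBY))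
      refine ⟨⟨⟨(Set.one_lt_ncard_iff_nontrivial).1 (by lia), solid_of_isTwoConnected hB.1⟩,
        fun Y hY hBY => (hmax Y hY.2 hBY).1⟩,
        hle.antisymm (hmax _ (solid_of_isTwoConnected hB.1) subset_rfl)⟩
  · rintro ⟨hB, heq⟩
    by_cases h3 : 3 ≤ B.verts.ncard
    · right
      rw [heq]
      refine ⟨isTwoConnected_induce_of_solid hB.solid h3, fun H hH hle => ?_⟩
      have hHB : H.verts ⊆ B.verts := hB.2
        ⟨hB.nontrivial.mono hle.1, solid_of_isTwoConnected hH⟩ hle.1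
      exact Subgraph.le_induce_top_verts.trans (Subgraph.induce_mono_right hHB)
    · left
      have h2 : B.verts.ncard = 2 := by
        have := (Set.one_lt_ncard_iff_nontrivial).2 hB.nontrivial
        lia
      obtain ⟨a, b, hab, hBab⟩ := Set.ncard_eq_two.1 h2
      rw [hBab] at heq hB
      obtain ⟨c, hc, hac⟩ := hB.solid.exists_adj hB.nontrivial (z := a) (by simp)
      obtain rfl : c = b := hc.resolve_left hac.ne'
      exact ⟨a, c, hac, hB.isBridge hac, by rw [Subgraph.subgraphOfAdj_eq_induce, heq]⟩

/-! ### Rerouting paths -/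

theorem Walk.IsPath.eq_of_mem_append {p : G.Walk a b} {q : G.Walk b c} (h : (p.append q).IsPath)
    (hp : x ∈ p.support) (hq : x ∈ q.support) : x = b := by
  have hn := h.support_nodup
  rw [Walk.support_append] at hn
  rw [← Walk.cons_tail_support] at hq
  exact (List.mem_cons.1 hq).resolve_right (List.disjoint_of_nodup_append hn hp)

/-- The part of a walk up to its first vertex in `A`. -/
theorem Walk.exists_isPath_first_mem (p : G.Walk a b) {A : Set V} (hb : b ∈ A) :
    ∃ c ∈ A, ∃ q : G.Walk a c, q.IsPath ∧ (∀ x ∈ q.support, x ∈ p.support) ∧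
      ∀ x ∈ q.support, x ∈ A → x = c := by
  classical
  suffices h : ∃ c ∈ A, ∃ q : G.Walk a c, (∀ x ∈ q.support, x ∈ p.support) ∧
      ∀ x ∈ q.support, x ∈ A → x = c by
    obtain ⟨c, hc, q, hq, hq'⟩ := h
    exact ⟨c, hc, q.bypass, q.bypass_isPath,
      fun x hx => hq x (q.support_bypass_subset_support hx),
      fun x hx => hq' x (q.support_bypass_subset_support hx)⟩
  induction p with
  | nil => exact ⟨_, hb, .nil, by simp, by simp⟩
  | @cons a' _ _ h p ih =>
    by_cases ha : a' ∈ A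
    · exact ⟨a', ha, .nil, by simp, by simp⟩
    · obtain ⟨c, hc, q, hq, hq'⟩ := ih hb
      refine ⟨c, hc, .cons h q, ?_, ?_⟩
      · intro x hx
        rw [Walk.support_cons, List.mem_cons] at hx ⊢
        exact hx.imp_right (hq x)
      · intro x hx hxA
        rw [Walk.support_cons, List.mem_cons] at hx
        rcases hx with rfl | hx
        · exact (ha hxA).elim
        · exact hq' x hx hxA

/-- The detour follows `p` to `v`, steps to `x`, takes `r` to `y`, and rejoins `q` there; `r` meets
the old path only at `y`. -/
theorem Walk.IsPath.exists_reroute_right {p : G.Walk u v} {q : G.Walk v w}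
    (hpq : (p.append q).IsPath) (hvx : G.Adj v x) {r : G.Walk x y} (hr : r.IsPath)
    (hvr : v ∉ r.support) (hy : y ∈ q.support)
    (hry : ∀ z ∈ r.support, z ∈ (p.append q).support → z = y) :
    ∃ p' : G.Walk u w, p'.IsPath ∧ v ∈ p'.support ∧ x ∈ p'.support := by
  classical
  have hyv : y ≠ v := fun h => hvr (h ▸ r.end_mem_support)
  have hsub : ∀ z ∈ (q.dropUntil y hy).support, z ∈ q.support :=
    fun z hz => q.support_dropUntil_subset_support hy hz
  refine ⟨p.append (.cons hvx (r.append (q.dropUntil y hy))), ?_, ?_, ?_⟩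
  · refine hpq.of_append_left.append ((Walk.cons_isPath_iff _ _).2
      ⟨hr.append (hpq.of_append_right.dropUntil hy) ?_, ?_⟩) ?_
    · intro z hz hz'
      exact hry z hz ((Walk.mem_support_append_iff _ _).2 (.inr (hsub z hz')))
    · rw [Walk.mem_support_append_iff]
      rintro (h | h)
      · exact hvr h
      · have hq : ((q.takeUntil y hy).append (q.dropUntil y hy)).IsPath := by
          rw [q.take_spec hy]
          exact hpq.of_append_right
        exact hyv (hq.eq_of_mem_append (Walk.start_mem_support _) h).symm
    · intro z hz hz'
      rw [Walk.support_cons, List.mem_cons, Walk.mem_support_append_iff] at hz'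
      rcases hz' with rfl | hz' | hz'
      · rfl
      · obtain rfl := hry z hz' ((Walk.mem_support_append_iff _ _).2 (.inl hz))
        exact hpq.eq_of_mem_append hz hy
      · exact hpq.eq_of_mem_append hz (hsub z hz')
  · simp [Walk.mem_support_append_iff]
  · simp [Walk.mem_support_append_iff]

/-- A path through `v` can be rerouted through a neighbour `x` of `v` from which the path can be
reached without using `v`. -/
theorem Walk.IsPath.exists_reroute {p : G.Walk u w} (hp : p.IsPath) (hv : v ∈ p.support)
    (hvx : G.Adj v x) (hy : y ∈ p.support) (h : G.LinkedIn {v}ᶜ x y) :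
    ∃ p' : G.Walk u w, p'.IsPath ∧ v ∈ p'.support ∧ x ∈ p'.support := by
  classical
  obtain ⟨r, hr⟩ := h
  obtain ⟨c, hc, q, hq, hqr, hqc⟩ := r.exists_isPath_first_mem (A := {z | z ∈ p.support}) hy
  have hvq : v ∉ q.support := fun h => hr v (hqr v h) rfl
  have hspec := p.take_spec hv
  have hpath : ((p.takeUntil v hv).append (p.dropUntil v hv)).IsPath := by rwa [hspec]
  have hc' : c ∈ ((p.takeUntil v hv).append (p.dropUntil v hv)).support := by rwa [hspec]
  rw [Walk.mem_support_append_iff] at hc'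
  rcases hc' with hc' | hc'
  -- If the detour returns to the path before `v`, reversing the path puts the return point after
  -- `v`.
  · have hrev : (p.dropUntil v hv).reverse.append (p.takeUntil v hv).reverse = p.reverse := by
      rw [← Walk.reverse_append, hspec]
    obtain ⟨p', hp', hvp, hxp⟩ := Walk.IsPath.exists_reroute_right
      (p := (p.dropUntil v hv).reverse) (q := (p.takeUntil v hv).reverse)
      (by rw [hrev]; exact hp.reverse) hvx hq hvq (by simpa using hc')
      (fun z hz hz' => hqc z hz (by rw [hrev] at hz'; simpa using hz'))
    exact ⟨p'.reverse, hp'.reverse, by simpa using hvp, by simpa using hxp⟩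
  · exact hpath.exists_reroute_right hvx hq hvq hc'
      (fun z hz hz' => hqc z hz (by rwa [hspec] at hz'))

/-- If an `s`-`t` path meets a solid set twice, every vertex of the set is on an `s`-`t` path. -/
theorem Solid.exists_isPath_mem (hX : G.Solid X) {p : G.Walk s t} (hp : p.IsPath)
    (hv : v ∈ p.support) (hw : w ∈ p.support) (hvw : v ≠ w) (hvX : v ∈ X) (hwX : w ∈ X)
    (hx : x ∈ X) : ∃ p : G.Walk s t, p.IsPath ∧ x ∈ p.support := by
  obtain ⟨q, hq⟩ := hX.linkedIn hvX hx
  clear hx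
  -- The path always carries the current vertex `v` of the walk and a second vertex `w` of `X`.
  -- After rerouting through the next vertex, the old `v` takes the role of `w`.
  induction q generalizing w p with
  | nil => exact ⟨p, hp, hv⟩
  | @cons v c _ h q ih =>
    have hcX : c ∈ X := hq c (by simp)
    obtain ⟨p', hp', hvp, hcp⟩ := hp.exists_reroute hv h hw
      (hX.linkedIn_compl hcX hwX h.ne' hvw.symm)
    exact ih hp' hcp hvp h.ne' hcX hvX fun z hz => hq z (by simp [hz])

/-! ### Blocks not separated from `S` -/

/-- No vertex of `X` separates `X` from `S`. -/
def Unseparated (G : SimpleGraph V) (S X : Set V) : Prop :=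
  ∀ z ∈ X, ∃ s ∈ S, ∃ b ∈ X, b ≠ z ∧ G.LinkedIn {z}ᶜ b s

theorem Walk.IsPath.mem_or_exists_exit {p : G.Walk c s} (hp : p.IsPath) (hc : c ∈ X) :
    s ∈ X ∨ ∃ g ∈ p.support, g ∈ X ∧ ∃ g', g' ∉ X ∧ G.Adj g g' ∧ G.LinkedIn {g}ᶜ g' s := by
  induction p with
  | nil => exact .inl hc
  | @cons c d _ h p ih =>
    rw [Walk.cons_isPath_iff] at hp
    by_cases hd : d ∈ X
    · refine (ih hp.1 hd).imp_right fun ⟨g, hg, hg'⟩ => ⟨g, by simp [hg], hg'⟩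
    · refine .inr ⟨c, by simp, hc, d, hd, h, p, ?_⟩
      rintro x hx rfl
      exact hp.2 hx

/-- Unseparatedness passes to the block entered when `X` is left towards `s`. Deleting `c` leaves
`s` reachable from `x`. Deleting another `z` of `Y` leaves the witness of `X` for `c` reachable: a
walk to it that avoids `c` but hits `z` would force `X = Y`. -/
theorem Unseparated.of_adj (hX : G.MaxSolid X) (hXS : G.Unseparated S X) (hc : c ∈ X)
    (hcd : G.Adj c x) (hx : x ∉ X) (hs : s ∈ S) (hxs : G.LinkedIn {c}ᶜ x s)
    (hY : G.MaxSolid Y) (hcY : c ∈ Y) (hxY : x ∈ Y) : G.Unseparated S Y := by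
  intro z hz
  by_cases hzc : z = c
  · subst hzc
    exact ⟨s, hs, x, hxY, hcd.ne', hxs⟩
  have hne : X ≠ Y := fun h => hx (h ▸ hxY)
  have hzX : z ∉ X := fun h => hne (hX.eq_of_mem hY hzc h hc hz hcY)
  obtain ⟨t, ht, b, hb, hbc, p, hp⟩ := hXS c hc
  refine ⟨t, ht, c, hcY, Ne.symm hzc, ((hX.solid.linkedIn hc hb).mono ?_).trans ⟨p, ?_⟩⟩
  · rintro v hv rfl
    exact hzX hv
  · classical
    rintro v hv rfl
    exact hne (hX.eq_of_linkedIn hY hc hcY hb hbc hz hzc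
      ⟨p.takeUntil v hv, fun w hw => hp w (p.support_takeUntil_subset_support hv hw)⟩)

/-- A deleted vertex misses one of the two parts of the path, and that part still joins its end of
the edge to `S`. -/
theorem Walk.IsPath.unseparated_of_adj {p : G.Walk s a} {q : G.Walk b t} {h : G.Adj a b}
    (hp : (p.append (.cons h q)).IsPath) (hs : s ∈ S) (ht : t ∈ S) (ha : a ∈ X) (hb : b ∈ X) :
    G.Unseparated S X := by
  have hcons := (Walk.cons_isPath_iff _ _).1 hp.of_append_right
  have hbp : b ∉ p.support := fun hb' => h.ne' (hp.eq_of_mem_append hb' (by simp))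
  intro z hz
  by_cases hzp : z ∈ p.support
  · refine ⟨t, ht, b, hb, fun h' => hbp (h' ▸ hzp), q, ?_⟩
    rintro x hx rfl
    obtain rfl := hp.eq_of_mem_append hzp (by simp [hx])
    exact hcons.2 hx
  · refine ⟨s, hs, a, ha, fun h' => hzp (h' ▸ p.end_mem_support), .symm ⟨p, ?_⟩⟩
    rintro x hx rfl
    exact hzp hx

theorem Walk.IsPath.exists_unseparated [Finite V] {p : G.Walk s t} (hp : p.IsPath) (hst : s ≠ t)
    (hs : s ∈ S) (ht : t ∈ S) (hv : v ∈ p.support) :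
    ∃ X, G.MaxSolid X ∧ v ∈ X ∧ G.Unseparated S X := by
  classical
  wlog hvt : v ≠ t generalizing s t
  · push Not at hvt
    subst hvt
    exact this hp.reverse hst.symm ht hs (by simp) hst.symm
  have hpath : ((p.takeUntil v hv).append (p.dropUntil v hv)).IsPath := by rwa [p.take_spec hv]
  revert hpath
  generalize p.dropUntil v hv = q
  intro hpath
  cases q with
  | nil => exact (hvt rfl).elim
  | cons h q =>
    obtain ⟨X, hvX, hcX, hX⟩ := h.exists_maxSolid
    exact ⟨X, hX, hvX, hpath.unseparated_of_adj hs ht hvX hcX⟩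

/-- The gate is `s` itself if `s ∈ X`. Otherwise it is a vertex where a path to `s` leaves `X`: a
second way out would pull the next vertex of that path into `X`. -/
theorem MaxSolid.exists_gate [Finite V] (hG : G.Connected) (hX : G.MaxSolid X) (s : V) :
    ∃ g ∈ X, ∀ b ∈ X, b ≠ g → ¬ G.LinkedIn {g}ᶜ b s := by
  obtain ⟨b, hb⟩ := hX.nontrivial.nonempty
  obtain ⟨p, hp⟩ := (hG.preconnected b s).exists_isPath
  rcases hp.mem_or_exists_exit hb with h | ⟨g, -, hg, g', hg', hadj, hlink⟩
  · exact ⟨s, h, fun b _ _ h => h.right_mem rfl⟩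
  · exact ⟨g, hg, fun c hc hcg h =>
      hg' (hX.mem_of_linkedIn hg hc hcg hadj (h.trans hlink.symm))⟩

theorem Unseparated.subset_allPathInterval [Finite V] (hG : G.Connected) (hX : G.MaxSolid X)
    (hXS : G.Unseparated S X) : X ⊆ allPathInterval G S := by
  classical
  intro x hx
  obtain ⟨s, hs, -⟩ := hXS x hx
  obtain ⟨g, hg, hgs⟩ := hX.exists_gate hG s
  obtain ⟨t, ht, b, hb, hbg, hbt⟩ := hXS g hg
  obtain ⟨p, hp⟩ := (hG.preconnected s t).exists_isPath
  have hgp : g ∈ p.support := by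
    by_contra hgp
    refine hgs b hb hbg (hbt.trans (.symm ⟨p, ?_⟩))
    rintro v hv rfl
    exact hgp hv
  have hpath : ((p.takeUntil g hgp).append (p.dropUntil g hgp)).IsPath := by
    rwa [p.take_spec hgp]
  have hsub := p.support_dropUntil_subset_support hgp
  revert hpath hsub
  generalize p.dropUntil g hgp = q
  intro hpath hsub
  cases q with
  | nil => exact (hbt.right_mem rfl).elim
  | @cons _ c _ h q =>
    have hcons := (Walk.cons_isPath_iff _ _).1 hpath.of_append_right
    have hct : G.LinkedIn {g}ᶜ c t := ⟨q, by rintro v hv rfl; exact hcons.2 hv⟩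
    -- Both `b` and the successor `c` of `g` reach `t` without `g`, so the path continues inside `X`
    -- and meets it twice.
    have hc : c ∈ X := hX.mem_of_linkedIn hg hb hbg h (hbt.trans hct.symm)
    obtain ⟨p', hp', hxp⟩ := hX.solid.exists_isPath_mem hp hgp (hsub (by simp)) h.ne hg hc hx
    exact .inr ⟨s, hs, t, ht, p', hp', hxp⟩

/-! ### Blocks, cut vertices and the block-cut tree -/

theorem maxSolid_block [Finite V] (B : {B : G.Subgraph // IsBlock G B}) :
    G.MaxSolid B.1.verts :=
  (isBlock_iff.1 B.2).1

theorem block_ext [Finite V] {B C : {B : G.Subgraph // IsBlock G B}}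
    (h : B.1.verts = C.1.verts) : B = C := by
  rw [Subtype.ext_iff, (isBlock_iff.1 B.2).2, (isBlock_iff.1 C.2).2, h]

theorem MaxSolid.exists_block [Finite V] (hX : G.MaxSolid X) :
    ∃ B : {B : G.Subgraph // IsBlock G B}, B.1.verts = X :=
  ⟨⟨(⊤ : G.Subgraph).induce X, isBlock_iff.2 ⟨hX, rfl⟩⟩, rfl⟩

theorem Adj.exists_block [Finite V] (h : G.Adj a b) :
    ∃ B : {B : G.Subgraph // IsBlock G B}, a ∈ B.1.verts ∧ b ∈ B.1.verts := by
  obtain ⟨X, ha, hb, hX⟩ := h.exists_maxSolid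
  obtain ⟨B, rfl⟩ := hX.exists_block
  exact ⟨B, ha, hb⟩

theorem block_eq_of_mem [Finite V] {B C : {B : G.Subgraph // IsBlock G B}} (hab : a ≠ b)
    (haB : a ∈ B.1.verts) (hbB : b ∈ B.1.verts) (haC : a ∈ C.1.verts) (hbC : b ∈ C.1.verts) :
    B = C :=
  block_ext ((maxSolid_block B).eq_of_mem (maxSolid_block C) hab haB hbB haC hbC)

theorem block_eq_of_linkedIn [Finite V] {B C : {B : G.Subgraph // IsBlock G B}}
    (hzB : z ∈ B.1.verts) (hzC : z ∈ C.1.verts) (ha : a ∈ B.1.verts) (haz : a ≠ z)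
    (hb : b ∈ C.1.verts) (hbz : b ≠ z) (h : G.LinkedIn {z}ᶜ a b) : B = C :=
  block_ext ((maxSolid_block B).eq_of_linkedIn (maxSolid_block C) hzB hzC ha haz hb hbz h)

theorem isCutVertex_induce_of_mem_blocks [Finite V] {B C : {B : G.Subgraph // IsBlock G B}}
    (hBC : B ≠ C) {z : U} (hzB : z.1 ∈ B.1.verts) (hzC : z.1 ∈ C.1.verts)
    (hBU : B.1.verts ⊆ U) (hCU : C.1.verts ⊆ U) : IsCutVertex (G.induce U) z := by
  obtain ⟨a, ha, haz⟩ := (maxSolid_block B).nontrivial.exists_ne z.1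
  obtain ⟨b, hb, hbz⟩ := (maxSolid_block C).nontrivial.exists_ne z.1
  exact isCutVertex_induce_iff.2 ⟨a, ⟨hBU ha, haz⟩, b, ⟨hCU hb, hbz⟩,
    (((maxSolid_block B).solid.linkedIn ha hzB).mono hBU).trans
      (((maxSolid_block C).solid.linkedIn hzC hb).mono hCU),
    fun h => hBC (block_eq_of_linkedIn hzB hzC ha haz hb hbz (h.mono fun _ hx => hx.2))⟩

theorem isCutVertex_of_mem_blocks [Finite V] (hG : G.Connected)
    {B C : {B : G.Subgraph // IsBlock G B}} (hBC : B ≠ C) (hzB : z ∈ B.1.verts)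
    (hzC : z ∈ C.1.verts) : IsCutVertex G z := by
  obtain ⟨a, ha, haz⟩ := (maxSolid_block B).nontrivial.exists_ne z
  obtain ⟨b, hb, hbz⟩ := (maxSolid_block C).nontrivial.exists_ne z
  exact isCutVertex_iff_linkedIn.2 ⟨a, b, haz, hbz, hG.preconnected a b,
    fun h => hBC (block_eq_of_linkedIn hzB hzC ha haz hb hbz h)⟩

theorem blockCutTree_isAcyclic [Finite V] (G : SimpleGraph V) : (blockCutTree G).IsAcyclic := by
  have key : ∀ (B : {B : G.Subgraph // IsBlock G B}) (z : {z : V // IsCutVertex G z}),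
      z.1 ∈ B.1.verts → (blockCutTree G).IsBridge s(.inl B, .inr z) := by
    rintro B z hz
    rw [isBridge_iff]
    rintro ⟨p⟩
    obtain ⟨b, hb, hbz⟩ := (maxSolid_block B).nontrivial.exists_ne z.1
    -- `N` marks the nodes having a vertex other than `z` in the component of `b` in `G - z`. Edges
    -- other than `B z` preserve it: a marked block containing `z` must be `B`. The node `z` is not
    -- marked.
    let N : BlockCutVertex G → Prop := Sum.elim
      (fun C => ∃ c ∈ C.1.verts, c ≠ z.1 ∧ G.LinkedIn {z.1}ᶜ b c)
      (fun y => G.LinkedIn {z.1}ᶜ b y.1)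
    have hstep : ∀ x y, ((blockCutTree G).deleteEdges {s(.inl B, .inr z)}).Adj x y →
        N x → N y := by
      rintro (C | y) (D | w) hadj hN <;> rw [deleteEdges_adj] at hadj
      · exact hadj.1.elim
      · obtain ⟨c, hc, hcz, hbc⟩ := hN
        have hwC : w.1 ∈ C.1.verts := hadj.1
        by_cases hwz : w = z
        · subst hwz
          obtain rfl := block_eq_of_linkedIn hz hwC hb hbz hc hcz hbc
          exact (hadj.2 rfl).elim
        · exact hbc.trans ((maxSolid_block C).solid.linkedIn_compl hc hwC hcz
            fun h => hwz (Subtype.ext h))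
      · have hN' : G.LinkedIn {z.1}ᶜ b y.1 := hN
        exact ⟨y.1, hadj.1, hN'.right_mem, hN'⟩
      · exact hadj.1.elim
    have hwalk : ∀ x y, ((blockCutTree G).deleteEdges {s(.inl B, .inr z)}).Walk x y →
        N x → N y := by
      intro x y p
      induction p with
      | nil => exact id
      | cons h _ ih => exact fun hN => ih (hstep _ _ h hN)
    have hN : G.LinkedIn {z.1}ᶜ b z.1 := hwalk _ _ p ⟨b, hb, hbz, .refl hbz⟩
    exact hN.right_mem rfl
  rw [isAcyclic_iff_forall_adj_isBridge]
  rintro (B | z) (C | w) h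
  · exact h.elim
  · exact key B w h
  · rw [Sym2.eq_swap]
    exact key C z h
  · exact h.elim

theorem mem_blockUnion {T : (blockCutTree G).Subgraph} :
    v ∈ blockUnion T ↔ ∃ B, .inl B ∈ T.verts ∧ v ∈ B.1.verts := by
  simp [blockUnion]

theorem verts_subset_blockUnion {T : (blockCutTree G).Subgraph}
    {B : {B : G.Subgraph // IsBlock G B}} (hB : .inl B ∈ T.verts) :
    B.1.verts ⊆ blockUnion T :=
  fun _ hv => mem_blockUnion.2 ⟨B, hB, hv⟩

/-! ### Blocks of admissible subtrees -/

/-- The leaves of an admissible subtree are blocks, so each of its cut vertices is in two of its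
blocks. -/
theorem _root_.IsLeafAdmissible.exists_two_blocks {T : (blockCutTree G).Subgraph}
    (hT : IsLeafAdmissible G S T) {z : {z : V // IsCutVertex G z}} (hz : .inr z ∈ T.verts) :
    ∃ B C : {B : G.Subgraph // IsBlock G B}, B ≠ C ∧ .inl B ∈ T.verts ∧ .inl C ∈ T.verts ∧
      z.1 ∈ B.1.verts ∧ z.1 ∈ C.1.verts := by
  have hn : (T.neighborSet (.inr z)).Nontrivial := by
    rw [← Set.not_subsingleton_iff]
    intro h
    obtain ⟨B, hB, -⟩ := hT.leaf _ hz h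
    cases hB
  obtain ⟨B | y, hx, C | w, hy, hne⟩ := hn
  · exact ⟨B, C, fun h => hne (congrArg _ h), hx.snd_mem, hy.snd_mem, hx.adj_sub, hy.adj_sub⟩
  · exact hy.adj_sub.elim
  · exact hx.adj_sub.elim
  · exact hx.adj_sub.elim

/-- Beyond every vertex of a block of an admissible subtree there is a vertex of `S`. -/
theorem _root_.IsLeafAdmissible.unseparated [Finite V] {T : (blockCutTree G).Subgraph}
    (hT : IsLeafAdmissible G S T) {B : {B : G.Subgraph // IsBlock G B}}
    (hB : .inl B ∈ T.verts) : G.Unseparated S B.1.verts := by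
  intro z hz
  induction hn : {x | ∃ b ∈ B.1.verts, b ≠ z ∧ G.LinkedIn {z}ᶜ b x}.ncard using
    Nat.strong_induction_on generalizing B z with
  | _ n ih =>
  subst hn
  by_cases hy : ∃ y, T.Adj (.inl B) (.inr y) ∧ y.1 ≠ z
  · obtain ⟨y, hBy, hyz⟩ := hy
    have hyB : y.1 ∈ B.1.verts := hBy.adj_sub
    obtain ⟨C, hCB, hC, hyC⟩ : ∃ C, C ≠ B ∧ .inl C ∈ T.verts ∧ y.1 ∈ C.1.verts := by
      obtain ⟨C, D, hCD, hC, hD, hyC, hyD⟩ := hT.exists_two_blocks hBy.snd_mem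
      by_cases h : C = B
      · exact ⟨D, h ▸ hCD.symm, hD, hyD⟩
      · exact ⟨C, h, hC, hyC⟩
    have hzC : z ∉ C.1.verts := fun h => hCB (block_eq_of_mem hyz hyC h hyB hz)
    have hlink : ∀ x, (∃ b ∈ C.1.verts, b ≠ y.1 ∧ G.LinkedIn {y.1}ᶜ b x) →
        G.LinkedIn {z}ᶜ y.1 x := by
      classical
      rintro x ⟨b, hb, hby, p, hp⟩
      refine (((maxSolid_block C).solid.linkedIn hyC hb).mono ?_).trans ⟨p, ?_⟩
      · rintro v hv rfl
        exact hzC hv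
      · rintro v hv rfl
        exact hCB (block_eq_of_linkedIn hyC hyB hb hby hz hyz.symm ⟨p.takeUntil v hv,
          fun w hw => hp w (p.support_takeUntil_subset_support hv hw)⟩)
    -- All that is reachable from `C` without `y` is reachable from `B` without `z`, while `y`
    -- itself drops out, so the measure decreases.
    obtain ⟨s, hs, hs'⟩ := ih _ (Set.ncard_lt_ncard ⟨fun x hx => ⟨y.1, hyB, hyz, hlink x hx⟩,
      fun h => by
        obtain ⟨b, -, -, hb⟩ := h ⟨y.1, hyB, hyz, .refl hyz⟩
        exact hb.right_mem rfl⟩ (Set.toFinite _)) hC _ hyC rfl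
    exact ⟨s, hs, y.1, hyB, hyz, hlink s hs'⟩
  · push Not at hy
    have hnbr : ∀ x, T.Adj (.inl B) x → ∃ y, x = .inr y ∧ y.1 = z := by
      rintro (C | y) h
      · exact h.adj_sub.elim
      · exact ⟨y, rfl, hy y h⟩
    obtain ⟨_, ⟨⟩, s, hs, hsB, hscut⟩ := hT.leaf _ hB (by
      intro x hx x' hx'
      obtain ⟨y, rfl, hy⟩ := hnbr x hx
      obtain ⟨y', rfl, hy'⟩ := hnbr x' hx'
      rw [Subtype.ext (hy.trans hy'.symm)])
    -- If `s = z`, then either `z` is a node of `T`, lies in two of its blocks and is a cut vertex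
    -- of their union, or `T` is the single node `B` and `nontrivial` gives another vertex of `S`.
    by_cases hsz : s.1 = z
    · by_cases hx : ∃ x, T.Adj (.inl B) x
      · obtain ⟨x, hx⟩ := hx
        obtain ⟨y, rfl, hyz⟩ := hnbr x hx
        obtain ⟨C, D, hCD, hC, hD, hyC, hyD⟩ := hT.exists_two_blocks hx.snd_mem
        rw [hyz, ← hsz] at hyC hyD
        exact (hscut (isCutVertex_induce_of_mem_blocks hCD hyC hyD
          (verts_subset_blockUnion hC) (verts_subset_blockUnion hD))).elim
      · push Not at hx
        obtain ⟨t, ht, htz⟩ := hT.nontrivial.exists_ne z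
        obtain ⟨C, hC, htC⟩ := mem_blockUnion.1 ht.2
        obtain ⟨p⟩ := hT.isTree.connected.preconnected ⟨.inl B, hB⟩ ⟨.inl C, hC⟩
        cases p with
        | nil => exact ⟨t, ht.1, t, htC, htz, .refl htz⟩
        | cons h _ => exact (hx _ h).elim
    · exact ⟨s, hs, s, hsB, hsz, .refl hsz⟩

/-! ### The subtree of unseparated blocks -/

/-- The blocks not separated from `S` by a vertex, and the cut vertices in two such blocks. -/
def unseparatedNodes (G : SimpleGraph V) (S : Set V) : Set (BlockCutVertex G) :=
  {x | match x with
    | .inl B => G.Unseparated S B.1.verts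
    | .inr z => ∃ B C : {B : G.Subgraph // IsBlock G B}, B ≠ C ∧ G.Unseparated S B.1.verts ∧
        G.Unseparated S C.1.verts ∧ z.1 ∈ B.1.verts ∧ z.1 ∈ C.1.verts}

theorem linkedIn_unseparatedNodes_of_mem [Finite V] (hG : G.Connected)
    {B C : {B : G.Subgraph // IsBlock G B}} (hB : G.Unseparated S B.1.verts)
    (hC : G.Unseparated S C.1.verts) (hzB : z ∈ B.1.verts) (hzC : z ∈ C.1.verts) :
    (blockCutTree G).LinkedIn (unseparatedNodes G S) (.inl B) (.inl C) := by
  by_cases hBC : B = C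
  · subst hBC
    exact .refl hB
  · have hz : IsCutVertex G z := isCutVertex_of_mem_blocks hG hBC hzB hzC
    have hz' : .inr ⟨z, hz⟩ ∈ unseparatedNodes G S := ⟨B, C, hBC, hB, hC, hzB, hzC⟩
    have hadj : (blockCutTree G).Adj (.inl B) (.inr ⟨z, hz⟩) := hzB
    have hadj' : (blockCutTree G).Adj (.inr ⟨z, hz⟩) (.inl C) := hzC
    exact (hadj.linkedIn hB hz').trans (hadj'.linkedIn hz' hC)

/-- Whenever the path leaves the current block, the block of the leaving edge is unseparated by
`Unseparated.of_adj` and shares the exit vertex. -/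
theorem Walk.IsPath.exists_linkedIn_unseparatedNodes [Finite V] (hG : G.Connected)
    {p : G.Walk c s} (hp : p.IsPath) (hs : s ∈ S) {B : {B : G.Subgraph // IsBlock G B}}
    (hB : G.Unseparated S B.1.verts) (hc : c ∈ B.1.verts) :
    ∃ C : {B : G.Subgraph // IsBlock G B}, s ∈ C.1.verts ∧ G.Unseparated S C.1.verts ∧
      (blockCutTree G).LinkedIn (unseparatedNodes G S) (.inl B) (.inl C) := by
  induction p generalizing B with
  | nil => exact ⟨B, hc, hB, .refl hB⟩
  | @cons c d _ h p ih =>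
    rw [Walk.cons_isPath_iff] at hp
    by_cases hd : d ∈ B.1.verts
    · exact ih hp.1 hs hB hd
    · obtain ⟨C, hcC, hdC⟩ := h.exists_block
      have hC : G.Unseparated S C.1.verts := hB.of_adj (maxSolid_block B) hc h hd hs
        ⟨p, by rintro x hx rfl; exact hp.2 hx⟩ (maxSolid_block C) hcC hdC
      obtain ⟨D, hsD, hD, hCD⟩ := ih hp.1 hs hC hdC
      exact ⟨D, hsD, hD, (linkedIn_unseparatedNodes_of_mem hG hB hC hc hcC).trans hCD⟩

theorem exists_unseparated_block [Finite V] (hG : G.Connected) (hS : S.Nontrivial) (hs : s ∈ S) :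
    ∃ B : {B : G.Subgraph // IsBlock G B}, s ∈ B.1.verts ∧ G.Unseparated S B.1.verts := by
  obtain ⟨t, ht, hts⟩ := hS.exists_ne s
  obtain ⟨p, hp⟩ := (hG.preconnected s t).exists_isPath
  obtain ⟨X, hX, hsX, hXS⟩ := hp.exists_unseparated hts.symm hs ht p.start_mem_support
  obtain ⟨B, rfl⟩ := hX.exists_block
  exact ⟨B, hsX, hXS⟩

theorem isTree_unseparatedNodes [Finite V] (hG : G.Connected) (hS : S.Nontrivial) :
    ((⊤ : (blockCutTree G).Subgraph).induce (unseparatedNodes G S)).coe.IsTree := by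
  obtain ⟨s, hs⟩ := hS.nonempty
  obtain ⟨B₀, hsB₀, hB₀⟩ := exists_unseparated_block hG hS hs
  have hblock : ∀ B : {B : G.Subgraph // IsBlock G B}, G.Unseparated S B.1.verts →
      (blockCutTree G).LinkedIn (unseparatedNodes G S) (.inl B) (.inl B₀) := by
    intro B hB
    obtain ⟨b, hb⟩ := (maxSolid_block B).nontrivial.nonempty
    obtain ⟨p, hp⟩ := (hG.preconnected b s).exists_isPath
    obtain ⟨C, hsC, hC, hBC⟩ := hp.exists_linkedIn_unseparatedNodes hG hs hB hb
    exact hBC.trans (linkedIn_unseparatedNodes_of_mem hG hC hB₀ hsC hsB₀)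
  have hnode : ∀ x ∈ unseparatedNodes G S,
      (blockCutTree G).LinkedIn (unseparatedNodes G S) x (.inl B₀) := by
    rintro (B | z) hx
    · exact hblock B hx
    · obtain ⟨B, C, -, hB, -, hzB, -⟩ := id hx
      have hadj : (blockCutTree G).Adj (.inr z) (.inl B) := hzB
      exact (hadj.linkedIn hx hB).trans (hblock B hB)
  have hc : ((blockCutTree G).induce (unseparatedNodes G S)).Connected := by
    have : Nonempty (unseparatedNodes G S) := ⟨⟨.inl B₀, hB₀⟩⟩
    exact ⟨fun x y => (linkedIn_iff_reachable_induce x.2 y.2).1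
      ((hnode x x.2).trans (hnode y y.2).symm)⟩
  rw [induce_eq_coe_induce_top] at hc
  exact ⟨hc, (blockCutTree_isAcyclic G).subgraph _⟩

theorem mem_blockUnion_unseparatedNodes :
    v ∈ blockUnion ((⊤ : (blockCutTree G).Subgraph).induce (unseparatedNodes G S)) ↔
      ∃ B : {B : G.Subgraph // IsBlock G B}, G.Unseparated S B.1.verts ∧ v ∈ B.1.verts :=
  mem_blockUnion

theorem blockUnion_unseparatedNodes [Finite V] (hG : G.Connected) (hS : S.Nontrivial) :
    allPathInterval G S =
      blockUnion ((⊤ : (blockCutTree G).Subgraph).induce (unseparatedNodes G S)) := by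
  ext v
  rw [mem_blockUnion_unseparatedNodes]
  constructor
  · have hmem : v ∈ S → ∃ B : {B : G.Subgraph // IsBlock G B},
        G.Unseparated S B.1.verts ∧ v ∈ B.1.verts := fun hv => by
      obtain ⟨B, hvB, hB⟩ := exists_unseparated_block hG hS hv
      exact ⟨B, hB, hvB⟩
    rintro (hv | ⟨s, hs, t, ht, p, hp, hv⟩)
    · exact hmem hv
    · by_cases hst : s = t
      · subst hst
        rw [(Walk.isPath_iff_nil.1 hp).eq_nil, Walk.support_nil, List.mem_singleton] at hv
        exact hmem (hv ▸ hs)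
      · obtain ⟨X, hX, hvX, hXS⟩ := hp.exists_unseparated hst hs ht hv
        obtain ⟨B, rfl⟩ := hX.exists_block
        exact ⟨B, hXS, hvX⟩
  · rintro ⟨B, hB, hv⟩
    exact hB.subset_allPathInterval hG (maxSolid_block B) hv

/-! ### The leaf condition and maximality -/

/-- A walk can be rerouted around `s` if the neighbours of `s` are joined without using `s`. -/
theorem LinkedIn.avoid (h : G.LinkedIn U a b)
    (hN : ∀ p ∈ U, ∀ q ∈ U, G.Adj s p → G.Adj s q → G.LinkedIn (U \ {s}) p q)
    (ha : a ≠ s) (hb : b ≠ s) : G.LinkedIn (U \ {s}) a b := by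
  obtain ⟨p, hp⟩ := h
  -- The second conjunct covers a walk standing at `s`: any neighbour by which `s` was entered can
  -- replace it as starting point.
  suffices (a ≠ s → G.LinkedIn (U \ {s}) a b) ∧
      (a = s → ∀ q ∈ U, G.Adj s q → G.LinkedIn (U \ {s}) q b) from this.1 ha
  clear ha
  induction p with
  | nil => exact ⟨fun h => .refl ⟨hp _ (by simp), h⟩, fun h => (hb h).elim⟩
  | @cons a c _ hac p ih =>
    have haU : a ∈ U := hp a (by simp)
    have hcU : c ∈ U := hp c (by simp)
    obtain ⟨ih₁, ih₂⟩ := ih hb fun x hx => hp x (by simp [hx])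
    constructor
    · intro has
      by_cases hcs : c = s
      · exact ih₂ hcs a haU (hcs ▸ hac.symm)
      · exact (hac.linkedIn (Z := U \ {s}) ⟨haU, has⟩ ⟨hcU, hcs⟩).trans (ih₁ hcs)
    · rintro rfl q hq haq
      exact (hN q hq c hcU haq hac).trans (ih₁ hac.ne')

/-- A vertex of `S` in only one block not separated from `S` is no cut vertex of the union of
these blocks. -/
theorem not_isCutVertex_of_unique_unseparated [Finite V]
    {B : {B : G.Subgraph // IsBlock G B}} (hB : G.Unseparated S B.1.verts)
    (hU : ∀ v, v ∈ U ↔ ∃ C : {B : G.Subgraph // IsBlock G B},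
      G.Unseparated S C.1.verts ∧ v ∈ C.1.verts)
    {s : U} (hs : s.1 ∈ S)
    (huniq : ∀ C : {B : G.Subgraph // IsBlock G B}, G.Unseparated S C.1.verts →
      s.1 ∈ C.1.verts → C = B) :
    ¬ IsCutVertex (G.induce U) s := by
  rw [isCutVertex_induce_iff]
  rintro ⟨a, ha, b, hb, hab, hcut⟩
  -- If `p` lies in an unseparated block without `s`, the block of the edge `s p` is unseparated
  -- too, because it leads to `s ∈ S`; by uniqueness it is `B`.
  have hnbr : ∀ p ∈ U, G.Adj s.1 p → p ∈ B.1.verts := by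
    intro p hp hsp
    obtain ⟨C, hC, hpC⟩ := (hU p).1 hp
    by_cases hsC : s.1 ∈ C.1.verts
    · rwa [← huniq C hC hsC]
    · obtain ⟨D, hsD, hpD⟩ := hsp.exists_block
      have hD : G.Unseparated S D.1.verts := hC.of_adj (maxSolid_block C) hpC hsp.symm hsC hs
        (.refl hsp.ne) (maxSolid_block D) hpD hsD
      rwa [← huniq D hD hsD]
  refine hcut (hab.avoid (fun p hp q hq hsp hsq => ?_) ha.2 hb.2)
  exact ((maxSolid_block B).solid.linkedIn_diff (hnbr p hp hsp) (hnbr q hq hsq)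
    hsp.ne' hsq.ne').mono (Set.sdiff_subset_sdiff_left fun v hv => (hU v).2 ⟨B, hB, hv⟩)

theorem isLeafAdmissible_unseparatedNodes [Finite V] (hG : G.Connected) (hS : S.Nontrivial) :
    IsLeafAdmissible G S
      ((⊤ : (blockCutTree G).Subgraph).induce (unseparatedNodes G S)) where
  isTree := isTree_unseparatedNodes hG hS
  nontrivial := by
    rw [← blockUnion_unseparatedNodes hG hS]
    exact hS.mono fun s hs => ⟨hs, .inl hs⟩
  leaf := by
    rintro (B | z) hx hsub
    · have hB : G.Unseparated S B.1.verts := hx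
      -- every neighbour of the leaf is `z`
      obtain ⟨z, hz, hzB⟩ : ∃ z ∈ B.1.verts, ∀ C : {B : G.Subgraph // IsBlock G B},
          G.Unseparated S C.1.verts → C ≠ B → ∀ y ∈ B.1.verts, y ∈ C.1.verts → y = z := by
        by_cases h : ∃ C : {B : G.Subgraph // IsBlock G B}, G.Unseparated S C.1.verts ∧ C ≠ B ∧
            ∃ z ∈ B.1.verts, z ∈ C.1.verts
        · have hmem : ∀ C : {B : G.Subgraph // IsBlock G B}, G.Unseparated S C.1.verts → C ≠ B →
              ∀ y ∈ B.1.verts, y ∈ C.1.verts → ∃ hy : IsCutVertex G y,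
                Sum.inr ⟨y, hy⟩ ∈ ((⊤ : (blockCutTree G).Subgraph).induce
                  (unseparatedNodes G S)).neighborSet (.inl B) :=
            fun C hC hCB y hyB hyC => ⟨isCutVertex_of_mem_blocks hG hCB hyC hyB,
              hx, ⟨C, B, hCB, hC, hB, hyC, hyB⟩, hyB⟩
          obtain ⟨C, hC, hCB, z, hz, hzC⟩ := h
          refine ⟨z, hz, fun D hD hDB y hyB hyD => ?_⟩
          obtain ⟨_, h₁⟩ := hmem C hC hCB z hz hzC
          obtain ⟨_, h₂⟩ := hmem D hD hDB y hyB hyD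
          exact congrArg Subtype.val (Sum.inr.inj (hsub h₂ h₁))
        · push Not at h
          obtain ⟨z, hz⟩ := (maxSolid_block B).nontrivial.nonempty
          exact ⟨z, hz, fun C hC hCB y hyB hyC => (h C hC hCB y hyB hyC).elim⟩
      obtain ⟨s, hs, b, hb, -, hbs⟩ := hB z hz
      have hsz : s ≠ z := hbs.right_mem
      obtain ⟨p, hp, hpz⟩ := hbs.exists_isPath
      -- A path to `s` leaving `B` at `g` would enter another unseparated block through `g`, forcing
      -- `g = z`, which the path avoids.
      have hsB : s ∈ B.1.verts := by
        refine (hp.mem_or_exists_exit hb).resolve_right ?_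
        rintro ⟨g, hgp, hg, g', hg', hadj, hlink⟩
        obtain ⟨C, hgC, hgC'⟩ := hadj.exists_block
        exact hpz g hgp (hzB C (hB.of_adj (maxSolid_block B) hg hadj hg' hs hlink
          (maxSolid_block C) hgC hgC') (fun h => hg' (h ▸ hgC')) g hg hgC)
      have hsU := mem_blockUnion_unseparatedNodes.2 ⟨B, hB, hsB⟩
      refine ⟨B, rfl, ⟨s, hsU⟩, hs, hsB, not_isCutVertex_of_unique_unseparated hB
        (fun _ => mem_blockUnion_unseparatedNodes) hs fun C hC hsC => ?_⟩
      by_contra hCB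
      exact hsz (hzB C hC hCB s hsB hsC)
    · obtain ⟨B, C, hBC, hB, hC, hzB, hzC⟩ := id hx
      have h₁ : Sum.inl B ∈ ((⊤ : (blockCutTree G).Subgraph).induce
        (unseparatedNodes G S)).neighborSet (.inr z) := ⟨hx, hB, hzB⟩
      have h₂ : Sum.inl C ∈ ((⊤ : (blockCutTree G).Subgraph).induce
        (unseparatedNodes G S)).neighborSet (.inr z) := ⟨hx, hC, hzC⟩
      exact (hBC (Sum.inl.inj (hsub h₁ h₂))).elim

theorem _root_.IsLeafAdmissible.le_unseparatedNodes [Finite V] {T : (blockCutTree G).Subgraph}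
    (hT : IsLeafAdmissible G S T) :
    T ≤ (⊤ : (blockCutTree G).Subgraph).induce (unseparatedNodes G S) := by
  refine Subgraph.le_induce_top_verts.trans (Subgraph.induce_mono_right ?_)
  rintro (B | z) hx
  · exact hT.unseparated hx
  · obtain ⟨B, C, hBC, hB, hC, hzB, hzC⟩ := hT.exists_two_blocks hx
    exact ⟨B, C, hBC, hT.unseparated hB, hT.unseparated hC, hzB, hzC⟩

end SimpleGraph

open SimpleGraph in
theorem mainTheorem2 {V : Type*} [Finite V] (G : SimpleGraph V) (hG : G.Connected)
    (S : Set V) (hS : 2 ≤ S.ncard) :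
    ∃ T : (blockCutTree G).Subgraph,
      IsMaximalSubtree G S T ∧ allPathInterval G S = blockUnion T := by
  have hS' : S.Nontrivial := Set.one_lt_ncard_iff_nontrivial.1 hS
  exact ⟨_, ⟨isLeafAdmissible_unseparatedNodes hG hS', fun _ hT => hT.le_unseparatedNodes⟩,
    blockUnion_unseparatedNodes hG hS'⟩
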